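/- **Conventions.** Let $A,B,C$ be (not necessarily unital) C*-algebras. An *$A$-$B$-correspondence* ${}_AX_B$ is a right Hilbert $B$-module $X$ together with a $*$-homomorphism $\varphi_X$ from $A$ into the algebra of adjointable operators on $X$ (neither non-degeneracy, nor injectivity, nor fullness is assumed). When $A=B$, $X$ is called a C*-correspondence over $A$. Two $A$-$B$-correspondences are *unitarily equivalent*, $X\approx Y$, if there is a unitary from $X$ onto $Y$ that intertwines the left and right actions. For ${}_AX_B$ and ${}_BY_C$, $X\otimes_BY$ denotes the interior tensor product, i.e. the $A$-$C$-correspondence obtained by (Hausdorff) completion of the algebraic tensor product in the inner product $\langle x\otimes y,x'\otimes y'\rangle=\langle y,\varphi_Y(\langle x,x'\rangle)y'\rangle$; and $E^{\otimes 1}=E$, $E^{\otimes (k+1)}=E\otimes_A E^{\otimes k}$. An *$A$-$B$-imprimitivity bimodule* is an $A$-$B$-correspondence $M$ with a left $A$-valued inner product ${}_M\langle\cdot,\cdot\rangle$ such that $\varphi_M({}_M\langle x,y\rangle)z=x\langle y,z\rangle$ and such that the linear spans of the values of the left and of the right inner product are dense in $A$ and in $B$, respectively. Let ${}_AE_A$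 and ${}_BF_B$ be C*-correspondences over $A$ and $B$. - $E\sim_{SME}F$ (strong Morita equivalence): there is an $A$-$B$-imprimitivity bimodule $M$ with $E\otimes_AM\approx M\otimes_BF$. - $E\sim_{ESSE}F$ (elementary strong shift equivalence): there are correspondences ${}_AR_B$ and ${}_BS_A$ with $E\approx R\otimes_BS$ and $F\approx S\otimes_AR$. - $E\sim_{SSE}F$ (strong shift equivalence): there are $n\ge 0$, C*-algebras $A_0,\dots,A_n$ and C*-correspondences $T_i$ over $A_i$ with $T_0=E$, $T_n=F$ and $T_i\sim_{ESSE}T_{i+1}$ for all $0\le i<n$. - $E\sim_{SE}F$ (shift equivalence): there are a lag $m\ge1$ and correspondences ${}_AR_B$ and ${}_BS_A$ with $E^{\otimes m}\approx R\otimes_BS$, $F^{\otimes m}\approx S\otimes_AR$, $E\otimes_AR\approx R\otimes_BF$ and $S\otimes_AE\approx F\otimes_BS$. **Theorem.** For arbitrary C*-correspondences ${}_AE_A$ and ${}_BF_B$, $$E\sim_{SME}F\ \Longrightarrow\ E\sim_{ESSE}F\ \Longrightarrow\ E\sim_{SSE}F\ \Longrightarrow\ E\sim_{SE}F .$$ 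-/

import Mathlib

open scoped TensorProduct
universe u v

/-- A correspondence without completeness and definiteness: a complex vector space with a right
`B`-action `rmul b x = x b`, a left `A`-action `lmul a x` by adjointable operators, and a positive
semidefinite `B`-valued inner product. -/
structure PreCorrespondence (A B : Type u) [NonUnitalCStarAlgebra A]
    [NonUnitalCStarAlgebra B] where
  carrier : Type v
  [addCommGroup : AddCommGroup carrier]
  [module : Module ℂ carrier]
  inner : carrier →ₗ⋆[ℂ] carrier →ₗ[ℂ] B
  rmul : B →ₗ[ℂ] Module.End ℂ carrier
  lmul : A →ₙₐ[ℂ] Module.End ℂ carrier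
  rmul_mul (b c : B) (x : carrier) : rmul (b * c) x = rmul c (rmul b x)
  inner_rmul (x y : carrier) (b : B) : inner x (rmul b y) = inner x y * b
  star_inner (x y : carrier) : star (inner x y) = inner y x
  inner_self_nonneg (x : carrier) : ∃ b : B, inner x x = star b * b
  inner_lmul (a : A) (x y : carrier) : inner (lmul a x) y = inner x (lmul (star a) y)

/-- A self-adjoint `G` with negative part `N` satisfies `N G N = -N ^ 3`, and `N ^ 3` is positive. -/
theorem exists_neg_part {R : Type*} [NonUnitalCStarAlgebra R] {G : R} (hG : IsSelfAdjoint G) :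
    ∃ N D : R, star N = N ∧ star N * G * N = -(star D * D) ∧ N * N * N = star D * D ∧
      (N = 0 → ∃ H, G = star H * H) := by
  let _ : PartialOrder R := CStarAlgebra.spectralOrder R
  have _ : StarOrderedRing R := CStarAlgebra.spectralOrderedRing R
  have hN0 : 0 ≤ G⁻ := CFC.negPart_nonneg G
  have hNsa : star G⁻ = G⁻ := IsSelfAdjoint.of_nonneg hN0
  have e1 : star G⁻ * G * G⁻ = -(G⁻ * G⁻ * G⁻) := by
    have h : star G⁻ * G * G⁻ = G⁻ * (G⁺ - G⁻) * G⁻ := by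
      rw [hNsa, CFC.posPart_sub_negPart G hG]
    rw [h, mul_sub, sub_mul, CFC.negPart_mul_posPart, zero_mul, zero_sub]
  have hpos : 0 ≤ G⁻ * G⁻ * G⁻ := by
    have := star_left_conjugate_nonneg hN0 G⁻
    rwa [hNsa] at this
  obtain ⟨D, hD⟩ := CStarAlgebra.nonneg_iff_eq_star_mul_self.1 hpos
  refine ⟨G⁻, D, hNsa, by rw [e1, hD], hD, fun h => ?_⟩
  exact CStarAlgebra.nonneg_iff_eq_star_mul_self.1 ((CFC.negPart_eq_zero_iff G hG).1 h)

namespace PreCorrespondence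

attribute [instance] PreCorrespondence.addCommGroup PreCorrespondence.module

variable {A B : Type u} [NonUnitalCStarAlgebra A] [NonUnitalCStarAlgebra B]
variable (P : PreCorrespondence.{u, v} A B)

theorem inner_rmul_left (x y : P.carrier) (b : B) :
    P.inner (P.rmul b x) y = star b * P.inner x y := by
  rw [← P.star_inner, P.inner_rmul, star_mul, P.star_inner]

theorem norm_inner_sq_le (x y : P.carrier) :
    ‖P.inner x y‖ ^ 2 ≤ ‖P.inner x x‖ * ‖P.inner y y‖ := by
  let _ : PartialOrder B := CStarAlgebra.spectralOrder B
  have _ : StarOrderedRing B := CStarAlgebra.spectralOrderedRing B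
  have key : ∀ s : ℝ, ‖P.inner x x‖ < s → ‖P.inner x y‖ ^ 2 ≤ s * ‖P.inner y y‖ := by
    intro s hs
    have hs0 : 0 < s := (norm_nonneg _).trans_lt hs
    set a := P.inner x y with ha
    have h1 : (0 : B) ≤ P.inner (P.rmul a x - (s : ℂ) • y) (P.rmul a x - (s : ℂ) • y) := by
      obtain ⟨b, hb⟩ := P.inner_self_nonneg (P.rmul a x - (s : ℂ) • y)
      rw [hb]; exact star_mul_self_nonneg b
    have h2 : P.inner (P.rmul a x - (s : ℂ) • y) (P.rmul a x - (s : ℂ) • y)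
        = star a * P.inner x x * a - s • (star a * a) - s • (star a * a)
          + s • s • P.inner y y := by
      have hyx : P.inner y x = star a := by rw [ha, P.star_inner]
      simp only [map_sub, LinearMap.sub_apply, P.inner_rmul, P.inner_rmul_left, map_smul,
        LinearMap.map_smulₛₗ, LinearMap.smul_apply, ← ha, hyx, Complex.conj_ofReal, mul_assoc]
      simp only [Complex.coe_smul, smul_sub]
      abel
    have h3 : star a * P.inner x x * a ≤ ‖P.inner x x‖ • (star a * a) :=
      CStarAlgebra.star_left_conjugate_le_norm_smul (by exact P.star_inner x x)
    have h4 : ‖P.inner x x‖ • (star a * a) ≤ s • (star a * a) :=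
      smul_le_smul_of_nonneg_right hs.le (star_mul_self_nonneg a)
    have h5 : s • (star a * a) ≤ s • s • P.inner y y := by
      rw [h2] at h1
      have h6 := h1.trans (add_le_add_left (sub_le_sub_right (sub_le_sub_right (h3.trans h4) _) _) _)
      rw [sub_self, zero_sub, neg_add_eq_sub, sub_nonneg] at h6
      exact h6
    have h7 : star a * a ≤ s • P.inner y y := (smul_le_smul_iff_of_pos_left hs0).1 h5
    have h8 := CStarAlgebra.norm_le_norm_of_nonneg_of_le (star_mul_self_nonneg a) h7
    rw [CStarRing.norm_star_mul_self, norm_smul, Real.norm_of_nonneg hs0.le] at h8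
    nlinarith
  have : Filter.Tendsto (fun s : ℝ => s * ‖P.inner y y‖) (nhdsWithin ‖P.inner x x‖ (Set.Ioi ‖P.inner x x‖))
      (nhds (‖P.inner x x‖ * ‖P.inner y y‖)) :=
    ((continuous_id.mul continuous_const).tendsto _).mono_left nhdsWithin_le_nhds
  exact ge_of_tendsto this (Filter.eventually_of_mem self_mem_nhdsWithin fun s hs => key s hs)

/-- The seminorm `‖x‖ = ‖⟨x, x⟩‖ ^ (1 / 2)`. -/
noncomputable instance : Norm P.carrier := ⟨fun x => Real.sqrt ‖P.inner x x‖⟩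

theorem norm_def (x : P.carrier) : ‖x‖ = Real.sqrt ‖P.inner x x‖ := rfl

theorem norm_sq (x : P.carrier) : ‖x‖ ^ 2 = ‖P.inner x x‖ :=
  Real.sq_sqrt (norm_nonneg _)

theorem norm_nonneg' (x : P.carrier) : 0 ≤ ‖x‖ := Real.sqrt_nonneg _

theorem norm_inner_le (x y : P.carrier) : ‖P.inner x y‖ ≤ ‖x‖ * ‖y‖ := by
  refine (pow_le_pow_iff_left₀ (norm_nonneg _)
    (mul_nonneg (P.norm_nonneg' x) (P.norm_nonneg' y)) two_ne_zero).1 ?_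
  rw [mul_pow, P.norm_sq, P.norm_sq]
  exact P.norm_inner_sq_le x y

theorem seminormCore : SeminormedSpace.Core ℂ P.carrier where
  norm_nonneg := P.norm_nonneg'
  norm_smul c x := by
    refine (pow_left_inj₀ (P.norm_nonneg' _)
      (mul_nonneg (norm_nonneg c) (P.norm_nonneg' x)) two_ne_zero).1 ?_
    rw [mul_pow, P.norm_sq, P.norm_sq]
    simp only [map_smul, LinearMap.map_smulₛₗ, LinearMap.smul_apply, norm_smul, RCLike.norm_conj]
    ring
  norm_triangle x y := by
    refine (pow_le_pow_iff_left₀ (P.norm_nonneg' _)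
      (add_nonneg (P.norm_nonneg' x) (P.norm_nonneg' y)) two_ne_zero).1 ?_
    rw [P.norm_sq]
    calc ‖P.inner (x + y) (x + y)‖
        = ‖(P.inner x x + P.inner y x) + (P.inner x y + P.inner y y)‖ := by
          simp only [map_add, LinearMap.add_apply]
      _ ≤ ‖P.inner x x + P.inner y x‖ + ‖P.inner x y + P.inner y y‖ := norm_add_le _ _
      _ ≤ (‖P.inner x x‖ + ‖P.inner y x‖) + (‖P.inner x y‖ + ‖P.inner y y‖) :=
          add_le_add (norm_add_le _ _) (norm_add_le _ _)
      _ ≤ (‖x‖ ^ 2 + ‖y‖ * ‖x‖) + (‖x‖ * ‖y‖ + ‖y‖ ^ 2) := by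
          rw [P.norm_sq, P.norm_sq]
          gcongr <;> exact P.norm_inner_le _ _
      _ = (‖x‖ + ‖y‖) ^ 2 := by ring

noncomputable instance : SeminormedAddCommGroup P.carrier :=
  SeminormedAddCommGroup.ofCore P.seminormCore

noncomputable instance : NormedSpace ℂ P.carrier where
  norm_smul_le c x := (P.seminormCore.norm_smul c x).le

theorem norm_rmul_le (b : B) (x : P.carrier) : ‖P.rmul b x‖ ≤ ‖b‖ * ‖x‖ := by
  refine (pow_le_pow_iff_left₀ (P.norm_nonneg' _)
    (mul_nonneg (norm_nonneg b) (P.norm_nonneg' x)) two_ne_zero).1 ?_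
  rw [mul_pow, P.norm_sq, P.norm_sq, P.inner_rmul, P.inner_rmul_left]
  calc ‖star b * P.inner x x * b‖ ≤ ‖star b‖ * ‖P.inner x x‖ * ‖b‖ :=
        (norm_mul_le _ _).trans (mul_le_mul_of_nonneg_right (norm_mul_le _ _) (norm_nonneg _))
    _ = ‖b‖ ^ 2 * ‖P.inner x x‖ := by rw [norm_star]; ring

theorem norm_lmul_le (a : A) (x : P.carrier) : ‖P.lmul a x‖ ≤ ‖a‖ * ‖x‖ := by
  let _ : PartialOrder B := CStarAlgebra.spectralOrder B
  have _ : StarOrderedRing B := CStarAlgebra.spectralOrderedRing B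
  let _ : PartialOrder (Unitization ℂ A) := CStarAlgebra.spectralOrder _
  have _ : StarOrderedRing (Unitization ℂ A) := CStarAlgebra.spectralOrderedRing _
  let L : Unitization ℂ A →ₐ[ℂ] Module.End ℂ P.carrier := Unitization.lift P.lmul
  have hL : ∀ a : A, L (a : Unitization ℂ A) = P.lmul a := fun a => by simp [L]
  have hadj : ∀ (c : Unitization ℂ A) (x y : P.carrier),
      P.inner (L c x) y = P.inner x (L (star c) y) := by
    intro c
    induction c using Unitization.ind with
    | inl_add_inr r a =>
      intro x y
      have e : (Unitization.inl r : Unitization ℂ A) = algebraMap ℂ _ r := rfl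
      have e' : (Unitization.inl (star r) : Unitization ℂ A) = algebraMap ℂ _ (star r) := rfl
      rw [star_add, map_add, map_add, ← Unitization.inl_star, ← Unitization.inr_star, e, e', hL, hL,
        AlgHom.commutes, AlgHom.commutes]
      simp [Module.algebraMap_end_apply, P.inner_lmul]
  obtain ⟨c, hc⟩ := CStarAlgebra.nonneg_iff_eq_star_mul_self.1
    (sub_nonneg.2 (CStarAlgebra.star_mul_le_algebraMap_norm_sq (a := (a : Unitization ℂ A))))
  have h1 : P.inner (L c x) (L c x)
      = (‖a‖ ^ 2) • P.inner x x - P.inner (P.lmul a x) (P.lmul a x) := by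
    rw [hadj, ← Module.End.mul_apply, ← map_mul, ← hc, map_sub, map_mul, ← Unitization.inr_star,
      hL, hL, Unitization.norm_inr, LinearMap.sub_apply, map_sub, Module.End.mul_apply,
      P.inner_lmul, IsScalarTower.algebraMap_apply ℝ ℂ (Unitization ℂ A), AlgHom.commutes,
      Module.algebraMap_end_apply, map_smul]
    congr 1
  have h2 : P.inner (P.lmul a x) (P.lmul a x) ≤ (‖a‖ ^ 2) • P.inner x x := by
    rw [← sub_nonneg, ← h1]
    obtain ⟨b, hb⟩ := P.inner_self_nonneg (L c x)
    rw [hb]; exact star_mul_self_nonneg b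
  have h3 : 0 ≤ P.inner (P.lmul a x) (P.lmul a x) := by
    obtain ⟨b, hb⟩ := P.inner_self_nonneg (P.lmul a x)
    rw [hb]; exact star_mul_self_nonneg b
  have h4 := CStarAlgebra.norm_le_norm_of_nonneg_of_le h3 h2
  rw [norm_smul, Real.norm_of_nonneg (by positivity), ← P.norm_sq, ← P.norm_sq, ← mul_pow] at h4
  exact (pow_le_pow_iff_left₀ (P.norm_nonneg' _)
    (mul_nonneg (norm_nonneg a) (P.norm_nonneg' x)) two_ne_zero).1 h4

/-- Gram matrices are positive in the C⋆-algebra of matrices. -/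
theorem exists_gram_eq {ι : Type*} [Fintype ι] (x : ι → P.carrier) :
    ∃ H : ι → ι → B, ∀ i j, P.inner (x i) (x j) = ∑ k, star (H k i) * H k j := by
  let _ : PartialOrder B := CStarAlgebra.spectralOrder B
  have _ : StarOrderedRing B := CStarAlgebra.spectralOrderedRing B
  let G : CStarMatrix ι ι B := CStarMatrix.ofMatrix (Matrix.of fun i j => P.inner (x i) (x j))
  have hGij : ∀ i j, G i j = P.inner (x i) (x j) := fun i j => rfl
  have hG : IsSelfAdjoint G := by
    ext i j
    exact P.star_inner (x j) (x i)
  obtain ⟨N, D, hNsa, e1, hD, hN⟩ := exists_neg_part hG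
  have e2 : ∀ i, (star N * G * N) i i
      = P.inner (∑ k, P.rmul (N k i) (x k)) (∑ k, P.rmul (N k i) (x k)) := by
    intro i
    simp only [map_sum, LinearMap.sum_apply, P.inner_rmul, P.inner_rmul_left]
    simp only [CStarMatrix.mul_apply, Finset.sum_mul, CStarMatrix.star_apply, hGij]
    try exact Finset.sum_comm
  have e3 : ∀ i, (star D * D) i i = ∑ k, star (D k i) * D k i := fun i => by
    simp only [CStarMatrix.mul_apply, CStarMatrix.star_apply]
  have e4 : ∀ i, ∑ k, star (D k i) * D k i = 0 := by
    intro i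
    refine le_antisymm ?_ (Finset.sum_nonneg fun k _ => star_mul_self_nonneg _)
    have : -(star D * D) i i = (star N * G * N) i i := by rw [e1]; rfl
    rw [← e3, ← neg_nonneg, this, e2]
    obtain ⟨b, hb⟩ := P.inner_self_nonneg (∑ k, P.rmul (N k i) (x k))
    rw [hb]; exact star_mul_self_nonneg b
  have e5 : D = 0 := by
    ext k i
    have := (Finset.sum_eq_zero_iff_of_nonneg
      (fun k _ => star_mul_self_nonneg (D k i))).1 (e4 i) k (Finset.mem_univ _)
    exact CStarRing.star_mul_self_eq_zero_iff _ |>.1 this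
  have e6 : N * N * N = 0 := by rw [hD, e5, mul_zero]
  have e7 : star (N * N) * (N * N) = 0 := by
    rw [star_mul, hNsa, ← mul_assoc, e6, zero_mul]
  have e8 : star N * N = 0 := by
    rw [hNsa]; exact (CStarRing.star_mul_self_eq_zero_iff _).1 e7
  obtain ⟨H, hH⟩ := hN ((CStarRing.star_mul_self_eq_zero_iff _).1 e8)
  refine ⟨fun k i => H k i, fun i j => ?_⟩
  rw [← hGij, hH, CStarMatrix.mul_apply]
  simp only [CStarMatrix.star_apply]


open UniformSpace

/-- The continuous extension of the inner product to the completion, as a function. -/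
noncomputable def innerFun (x y : Completion P.carrier) : B :=
  (Completion.isDenseInducing_coe.prodMap Completion.isDenseInducing_coe).extend
    (fun p : P.carrier × P.carrier => P.inner p.1 p.2) (x, y)

theorem continuous_inner : Continuous fun p : P.carrier × P.carrier => P.inner p.1 p.2 := by
  let f : P.carrier →L⋆[ℂ] P.carrier →L[ℂ] B :=
    LinearMap.mkContinuous₂ P.inner 1 fun x y => by
      rw [one_mul]; exact P.norm_inner_le x y
  exact (f.continuous.comp continuous_fst).clm_apply continuous_snd

theorem innerFun_coe (x y : P.carrier) : P.innerFun x y = P.inner x y :=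
  (Completion.isDenseInducing_coe.prodMap Completion.isDenseInducing_coe).extend_eq
    P.continuous_inner (x, y)

theorem continuous_innerFun :
    Continuous fun p : Completion P.carrier × Completion P.carrier => P.innerFun p.1 p.2 := by
  let φ : P.carrier →+ P.carrier →+ B :=
    { toFun := fun x => (P.inner x).toAddMonoidHom
      map_zero' := by ext; simp
      map_add' := fun x y => by ext; simp }
  have h : Continuous fun p : P.carrier × P.carrier => φ p.1 p.2 := P.continuous_inner
  change Continuous (((Completion.isDenseInducing_toCompl P.carrier).prodMap
    (Completion.isDenseInducing_toCompl P.carrier)).extend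
      fun p : P.carrier × P.carrier => φ p.1 p.2)
  exact (Completion.isDenseInducing_toCompl P.carrier).extend_Z_bilin
    (Completion.isDenseInducing_toCompl P.carrier) h

theorem continuous_innerFun_comp {T : Type*} [TopologicalSpace T] {f g : T → Completion P.carrier}
    (hf : Continuous f) (hg : Continuous g) : Continuous fun t => P.innerFun (f t) (g t) :=
  P.continuous_innerFun.comp (hf.prodMk hg)

/-- The continuous extension of the inner product to the completion. -/
noncomputable def complInner : Completion P.carrier →ₗ⋆[ℂ] Completion P.carrier →ₗ[ℂ] B :=
  LinearMap.mk₂'ₛₗ (starRingEnd ℂ) (RingHom.id ℂ) P.innerFun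
    (fun x y z => by
      refine Completion.induction_on₃ x y z ?_ fun x y z => ?_
      · have h1 := P.continuous_innerFun_comp
          (T := Completion P.carrier × Completion P.carrier × Completion P.carrier)
          (continuous_fst.add (continuous_fst.comp continuous_snd))
          (continuous_snd.comp continuous_snd)
        have h2 := P.continuous_innerFun_comp
          (T := Completion P.carrier × Completion P.carrier × Completion P.carrier)
          continuous_fst (continuous_snd.comp continuous_snd)
        have h3 := P.continuous_innerFun_comp
          (T := Completion P.carrier × Completion P.carrier × Completion P.carrier)
          (continuous_fst.comp continuous_snd) (continuous_snd.comp continuous_snd)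
        exact isClosed_eq h1 (h2.add h3)
      · rw [← Completion.coe_add, innerFun_coe, innerFun_coe, innerFun_coe, map_add,
          LinearMap.add_apply])
    (fun c x y => by
      refine Completion.induction_on₂ x y ?_ fun x y => ?_
      · exact isClosed_eq
          (P.continuous_innerFun_comp (continuous_fst.const_smul c) continuous_snd)
          ((P.continuous_innerFun_comp continuous_fst continuous_snd).const_smul _)
      · rw [← Completion.coe_smul, innerFun_coe, innerFun_coe, LinearMap.map_smulₛₗ,
          LinearMap.smul_apply])
    (fun x y z => by
      refine Completion.induction_on₃ x y z ?_ fun x y z => ?_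
      · have h1 := P.continuous_innerFun_comp
          (T := Completion P.carrier × Completion P.carrier × Completion P.carrier)
          continuous_fst
          ((continuous_fst.comp continuous_snd).add (continuous_snd.comp continuous_snd))
        have h2 := P.continuous_innerFun_comp
          (T := Completion P.carrier × Completion P.carrier × Completion P.carrier)
          continuous_fst (continuous_fst.comp continuous_snd)
        have h3 := P.continuous_innerFun_comp
          (T := Completion P.carrier × Completion P.carrier × Completion P.carrier)
          continuous_fst (continuous_snd.comp continuous_snd)
        exact isClosed_eq h1 (h2.add h3)
      · rw [← Completion.coe_add, innerFun_coe, innerFun_coe, innerFun_coe, map_add])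
    (fun c x y => by
      refine Completion.induction_on₂ x y ?_ fun x y => ?_
      · exact isClosed_eq
          (P.continuous_innerFun_comp continuous_fst (continuous_snd.const_smul c))
          ((P.continuous_innerFun_comp continuous_fst continuous_snd).const_smul _)
      · rw [← Completion.coe_smul, innerFun_coe, innerFun_coe, map_smul, RingHom.id_apply])

theorem complInner_coe (x y : P.carrier) :
    P.complInner (x : Completion P.carrier) (y : Completion P.carrier) = P.inner x y :=
  P.innerFun_coe x y

theorem continuous_complInner {T : Type*} [TopologicalSpace T] {f g : T → Completion P.carrier}
    (hf : Continuous f) (hg : Continuous g) : Continuous fun t => P.complInner (f t) (g t) :=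
  P.continuous_innerFun_comp hf hg

/-- The continuous extension of a bounded operator to the completion. -/
noncomputable def complMap (f : P.carrier →L[ℂ] P.carrier) :
    Completion P.carrier →L[ℂ] Completion P.carrier :=
  (Completion.toComplL.comp f).extend Completion.toComplL

theorem complMap_coe (f : P.carrier →L[ℂ] P.carrier) (x : P.carrier) :
    P.complMap f (x : Completion P.carrier) = (f x : P.carrier) :=
  (Completion.toComplL.comp f).extend_eq (e := Completion.toComplL) Completion.denseRange_coe
    (Completion.isUniformInducing_coe _) x

/-- The right action of `b` as a bounded operator. -/
noncomputable def rmulL (b : B) : P.carrier →L[ℂ] P.carrier :=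
  (P.rmul b).mkContinuous ‖b‖ (P.norm_rmul_le b)

/-- The left action of `a` as a bounded operator. -/
noncomputable def lmulL (a : A) : P.carrier →L[ℂ] P.carrier :=
  (P.lmul a).mkContinuous ‖a‖ (P.norm_lmul_le a)

theorem complMap_ext {f g : Completion P.carrier →ₗ[ℂ] Completion P.carrier} (hf : Continuous f)
    (hg : Continuous g) (h : ∀ x : P.carrier, f x = g x) : f = g :=
  LinearMap.ext fun x => Completion.induction_on x (isClosed_eq hf hg) h

/-- The continuous extension of the right action to the completion. -/
noncomputable def complRmul : B →ₗ[ℂ] Module.End ℂ (Completion P.carrier) where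
  toFun b := (P.complMap (P.rmulL b)).toLinearMap
  map_add' b c := by
    refine P.complMap_ext (P.complMap _).continuous
      ((P.complMap _).continuous.add (P.complMap _).continuous) fun x => ?_
    change P.complMap _ _ = P.complMap _ _ + P.complMap _ _
    rw [complMap_coe, complMap_coe, complMap_coe, ← Completion.coe_add]
    change ((P.rmul (b + c) x : P.carrier) : Completion P.carrier) = _
    rw [map_add]; rfl
  map_smul' r b := by
    refine P.complMap_ext (P.complMap _).continuous
      ((P.complMap _).continuous.const_smul r) fun x => ?_
    change P.complMap _ _ = r • P.complMap _ _
    rw [complMap_coe, complMap_coe, ← Completion.coe_smul]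
    change ((P.rmul (r • b) x : P.carrier) : Completion P.carrier) = _
    rw [map_smul]; rfl

theorem complRmul_coe (b : B) (x : P.carrier) :
    P.complRmul b (x : Completion P.carrier) = (P.rmul b x : P.carrier) := P.complMap_coe _ x

theorem continuous_complRmul (b : B) : Continuous (P.complRmul b) := (P.complMap _).continuous

/-- The continuous extension of the left action to the completion. -/
noncomputable def complLmul : A →ₙₐ[ℂ] Module.End ℂ (Completion P.carrier) where
  toFun a := (P.complMap (P.lmulL a)).toLinearMap
  map_add' a b := by
    refine P.complMap_ext (P.complMap _).continuous
      ((P.complMap _).continuous.add (P.complMap _).continuous) fun x => ?_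
    change P.complMap _ _ = P.complMap _ _ + P.complMap _ _
    rw [complMap_coe, complMap_coe, complMap_coe, ← Completion.coe_add]
    change ((P.lmul (a + b) x : P.carrier) : Completion P.carrier) = _
    rw [map_add]; rfl
  map_smul' r a := by
    refine P.complMap_ext (P.complMap _).continuous
      ((P.complMap _).continuous.const_smul r) fun x => ?_
    change P.complMap _ _ = r • P.complMap _ _
    rw [complMap_coe, complMap_coe, ← Completion.coe_smul]
    change ((P.lmul (r • a) x : P.carrier) : Completion P.carrier) = _
    rw [map_smul]; rfl
  map_zero' := by
    refine P.complMap_ext (P.complMap _).continuous continuous_const fun x => ?_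
    change P.complMap _ _ = 0
    rw [complMap_coe]
    change ((P.lmul 0 x : P.carrier) : Completion P.carrier) = _
    rw [map_zero]; rfl
  map_mul' a b := by
    refine P.complMap_ext (P.complMap _).continuous
      ((P.complMap _).continuous.comp (P.complMap _).continuous) fun x => ?_
    change P.complMap _ _ = P.complMap _ (P.complMap _ _)
    rw [complMap_coe, complMap_coe, complMap_coe]
    change ((P.lmul (a * b) x : P.carrier) : Completion P.carrier) = _
    rw [map_mul]; rfl

theorem complLmul_coe (a : A) (x : P.carrier) :
    P.complLmul a (x : Completion P.carrier) = (P.lmul a x : P.carrier) := P.complMap_coe _ x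

theorem continuous_complLmul (a : A) : Continuous (P.complLmul a) := (P.complMap _).continuous

theorem complNorm_sq (x : Completion P.carrier) : ‖x‖ ^ 2 = ‖P.complInner x x‖ :=
  Completion.induction_on x
    (isClosed_eq (continuous_norm.pow 2) (P.continuous_complInner continuous_id continuous_id).norm)
    fun x => by rw [P.complInner_coe, Completion.norm_coe, P.norm_sq]

end PreCorrespondence

/-- An `A`-`B`-correspondence `X`: a right Hilbert `B`-module (a complex vector space with a right
`B`-action and a `B`-valued inner product, conjugate linear in the first and linear in the second
variable, that is complete in the norm `‖x‖ = ‖⟨x, x⟩‖ ^ (1 / 2)`) together with a ⋆-homomorphism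
`φ` of `A` into the adjointable operators of `X`. Here `rmul b x` is `x b` and `lmul a x` is
`φ(a) x`; the last field says that `φ(a⋆)` is an adjoint of `φ(a)`. An element of a C⋆-algebra is
positive if and only if it is of the form `b⋆ b`. -/
structure Correspondence (A B : Type u) [NonUnitalCStarAlgebra A]
    [NonUnitalCStarAlgebra B] where
  carrier : Type v
  [normedAddCommGroup : NormedAddCommGroup carrier]
  [normedSpace : NormedSpace ℂ carrier]
  [completeSpace : CompleteSpace carrier]
  inner : carrier →ₗ⋆[ℂ] carrier →ₗ[ℂ] B
  rmul : B →ₗ[ℂ] Module.End ℂ carrier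
  lmul : A →ₙₐ[ℂ] Module.End ℂ carrier
  rmul_mul (b c : B) (x : carrier) : rmul (b * c) x = rmul c (rmul b x)
  inner_rmul (x y : carrier) (b : B) : inner x (rmul b y) = inner x y * b
  star_inner (x y : carrier) : star (inner x y) = inner y x
  inner_self_nonneg (x : carrier) : ∃ b : B, inner x x = star b * b
  inner_self_eq_zero (x : carrier) : inner x x = 0 → x = 0
  norm_sq (x : carrier) : ‖x‖ ^ 2 = ‖inner x x‖
  inner_lmul (a : A) (x y : carrier) : inner (lmul a x) y = inner x (lmul (star a) y)

attribute [instance] Correspondence.normedAddCommGroup Correspondence.normedSpace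
  Correspondence.completeSpace

section

variable {A B C : Type u} [NonUnitalCStarAlgebra A] [NonUnitalCStarAlgebra B]
  [NonUnitalCStarAlgebra C]

open UniformSpace in
/-- The (Hausdorff) completion of a pre-correspondence. -/
noncomputable def PreCorrespondence.completion (P : PreCorrespondence.{u, v} A B) :
    Correspondence.{u, v} A B where
  carrier := Completion P.carrier
  inner := P.complInner
  rmul := P.complRmul
  lmul := P.complLmul
  rmul_mul b c x :=
    Completion.induction_on x
      (isClosed_eq (P.continuous_complRmul _)
        ((P.continuous_complRmul _).comp (P.continuous_complRmul _)))
      fun x => by rw [P.complRmul_coe, P.complRmul_coe, P.complRmul_coe, P.rmul_mul]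
  inner_rmul x y b :=
    Completion.induction_on₂ x y
      (isClosed_eq
        (P.continuous_complInner continuous_fst ((P.continuous_complRmul _).comp continuous_snd))
        ((P.continuous_complInner continuous_fst continuous_snd).mul continuous_const))
      fun x y => by rw [P.complRmul_coe, P.complInner_coe, P.complInner_coe, P.inner_rmul]
  star_inner x y :=
    Completion.induction_on₂ x y
      (isClosed_eq (P.continuous_complInner continuous_fst continuous_snd).star
        (P.continuous_complInner continuous_snd continuous_fst))
      fun x y => by rw [P.complInner_coe, P.complInner_coe, P.star_inner]
  inner_self_nonneg x := by
    let _ : PartialOrder B := CStarAlgebra.spectralOrder B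
    have _ : StarOrderedRing B := CStarAlgebra.spectralOrderedRing B
    rw [← CStarAlgebra.nonneg_iff_eq_star_mul_self]
    refine Completion.induction_on x
      (isClosed_le continuous_const (P.continuous_complInner continuous_id continuous_id))
      fun x => ?_
    rw [P.complInner_coe]
    exact CStarAlgebra.nonneg_iff_eq_star_mul_self.2 (P.inner_self_nonneg x)
  inner_self_eq_zero x hx := by
    have h := P.complNorm_sq x
    rw [hx] at h
    simpa using h
  norm_sq := P.complNorm_sq
  inner_lmul a x y :=
    Completion.induction_on₂ x y
      (isClosed_eq
        (P.continuous_complInner ((P.continuous_complLmul _).comp continuous_fst) continuous_snd)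
        (P.continuous_complInner continuous_fst ((P.continuous_complLmul _).comp continuous_snd)))
      fun x y => by
        rw [P.complLmul_coe, P.complLmul_coe, P.complInner_coe, P.complInner_coe, P.inner_lmul]

namespace Correspondence

/-- A correspondence is a pre-correspondence. -/
def toPre (X : Correspondence.{u, v} A B) : PreCorrespondence.{u, v} A B where
  carrier := X.carrier
  inner := X.inner
  rmul := X.rmul
  lmul := X.lmul
  rmul_mul := X.rmul_mul
  inner_rmul := X.inner_rmul
  star_inner := X.star_inner
  inner_self_nonneg := X.inner_self_nonneg
  inner_lmul := X.inner_lmul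

/-- The functional `x' ⊗ y' ↦ ⟨y, φ_Y(⟨x, x'⟩) y'⟩` on the algebraic tensor product. -/
noncomputable def tensorInnerAux (X : Correspondence.{u, v} A B) (Y : Correspondence.{u, v} B C)
    (x : X.carrier) (y : Y.carrier) : X.carrier ⊗[ℂ] Y.carrier →ₗ[ℂ] C :=
  TensorProduct.lift (LinearMap.mk₂ ℂ (fun x' y' => Y.inner y (Y.lmul (X.inner x x') y'))
    (fun _ _ _ => by simp) (fun _ _ _ => by simp) (fun _ _ _ => by simp) (fun _ _ _ => by simp))

theorem tensorInnerAux_tmul (X : Correspondence.{u, v} A B) (Y : Correspondence.{u, v} B C)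
    (x x' : X.carrier) (y y' : Y.carrier) :
    tensorInnerAux X Y x y (x' ⊗ₜ y') = Y.inner y (Y.lmul (X.inner x x') y') := rfl

/-- The inner product `⟨x ⊗ y, x' ⊗ y'⟩ = ⟨y, φ_Y(⟨x, x'⟩) y'⟩` on the algebraic tensor product. -/
noncomputable def tensorInner (X : Correspondence.{u, v} A B) (Y : Correspondence.{u, v} B C) :
    X.carrier ⊗[ℂ] Y.carrier →ₗ⋆[ℂ] X.carrier ⊗[ℂ] Y.carrier →ₗ[ℂ] C :=
  TensorProduct.lift (LinearMap.mk₂'ₛₗ (starRingEnd ℂ) (starRingEnd ℂ) (tensorInnerAux X Y)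
    (fun _ _ _ => by ext; simp [tensorInnerAux_tmul])
    (fun _ _ _ => by ext; simp [tensorInnerAux_tmul])
    (fun _ _ _ => by ext; simp [tensorInnerAux_tmul])
    (fun _ _ _ => by ext; simp [tensorInnerAux_tmul]))

theorem tensorInner_tmul (X : Correspondence.{u, v} A B) (Y : Correspondence.{u, v} B C)
    (x x' : X.carrier) (y y' : Y.carrier) :
    tensorInner X Y (x ⊗ₜ y) (x' ⊗ₜ y') = Y.inner y (Y.lmul (X.inner x x') y') := rfl

section preTensor

variable (X : Correspondence.{u, v} A B) (Y : Correspondence.{u, v} B C)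

/-- The right action `(x ⊗ y) c = x ⊗ y c` on the algebraic tensor product. -/
noncomputable def tensorRmul : C →ₗ[ℂ] Module.End ℂ (X.carrier ⊗[ℂ] Y.carrier) where
  toFun c := (Y.rmul c).lTensor X.carrier
  map_add' c d := by rw [map_add, LinearMap.lTensor_add]
  map_smul' r c := by rw [map_smul, LinearMap.lTensor_smul, RingHom.id_apply]

theorem tensorRmul_tmul (c : C) (x : X.carrier) (y : Y.carrier) :
    tensorRmul X Y c (x ⊗ₜ y) = x ⊗ₜ Y.rmul c y := rfl

/-- The left action `a (x ⊗ y) = φ_X(a) x ⊗ y` on the algebraic tensor product. -/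
noncomputable def tensorLmul : A →ₙₐ[ℂ] Module.End ℂ (X.carrier ⊗[ℂ] Y.carrier) where
  toFun a := (X.lmul a).rTensor Y.carrier
  map_add' a b := by rw [map_add, LinearMap.rTensor_add]
  map_smul' r a := by rw [map_smul, LinearMap.rTensor_smul, MonoidHom.id_apply]
  map_zero' := by rw [map_zero, LinearMap.rTensor_zero]
  map_mul' a b := by rw [map_mul, LinearMap.rTensor_mul]

theorem tensorLmul_tmul (a : A) (x : X.carrier) (y : Y.carrier) :
    tensorLmul X Y a (x ⊗ₜ y) = X.lmul a x ⊗ₜ y := rfl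

theorem tensorRmul_mul (c d : C) (t : X.carrier ⊗[ℂ] Y.carrier) :
    tensorRmul X Y (c * d) t = tensorRmul X Y d (tensorRmul X Y c t) := by
  induction t using TensorProduct.induction_on with
  | zero => simp only [map_zero]
  | tmul x y => simp only [tensorRmul_tmul, Y.rmul_mul]
  | add s t hs ht => simp only [map_add, hs, ht]

theorem tensorInner_rmul (s t : X.carrier ⊗[ℂ] Y.carrier) (c : C) :
    tensorInner X Y s (tensorRmul X Y c t) = tensorInner X Y s t * c := by
  induction s using TensorProduct.induction_on with
  | zero => simp only [map_zero, LinearMap.zero_apply, zero_mul]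
  | add s s' hs hs' => simp only [map_add, LinearMap.add_apply, hs, hs', add_mul]
  | tmul x y =>
    induction t using TensorProduct.induction_on with
    | zero => simp only [map_zero, zero_mul]
    | add t t' ht ht' => simp only [map_add, ht, ht', add_mul]
    | tmul x' y' =>
      have h : ∀ (b : B) (z : Y.carrier),
          Y.inner y (Y.lmul b z) = Y.inner (Y.lmul (star b) y) z := fun b z => by
        rw [Y.inner_lmul, star_star]
      rw [tensorRmul_tmul, tensorInner_tmul, tensorInner_tmul, h, h, Y.inner_rmul]

theorem star_tensorInner (s t : X.carrier ⊗[ℂ] Y.carrier) :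
    star (tensorInner X Y s t) = tensorInner X Y t s := by
  induction s using TensorProduct.induction_on with
  | zero => simp only [map_zero, LinearMap.zero_apply, star_zero]
  | add s s' hs hs' => simp only [map_add, LinearMap.add_apply, star_add, hs, hs']
  | tmul x y =>
    induction t using TensorProduct.induction_on with
    | zero => simp only [map_zero, LinearMap.zero_apply, star_zero]
    | add t t' ht ht' => simp only [map_add, LinearMap.add_apply, star_add, ht, ht']
    | tmul x' y' =>
      rw [tensorInner_tmul, tensorInner_tmul, Y.star_inner, Y.inner_lmul, X.star_inner]

theorem tensorInner_self_nonneg (t : X.carrier ⊗[ℂ] Y.carrier) :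
    ∃ c : C, tensorInner X Y t t = star c * c := by
  let _ : PartialOrder C := CStarAlgebra.spectralOrder C
  have _ : StarOrderedRing C := CStarAlgebra.spectralOrderedRing C
  rw [← CStarAlgebra.nonneg_iff_eq_star_mul_self]
  obtain ⟨S, rfl⟩ := TensorProduct.exists_finset t
  obtain ⟨H, hH⟩ := X.toPre.exists_gram_eq (fun i : S => i.1.1)
  have hH' : ∀ i j : S, X.inner i.1.1 j.1.1 = ∑ k, star (H k i) * H k j := hH
  have h : ∀ i j : S, tensorInner X Y (i.1.1 ⊗ₜ i.1.2) (j.1.1 ⊗ₜ j.1.2)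
      = ∑ k, Y.inner (Y.lmul (H k i) i.1.2) (Y.lmul (H k j) j.1.2) := by
    intro i j
    rw [tensorInner_tmul, hH', map_sum, LinearMap.sum_apply, map_sum]
    refine Finset.sum_congr rfl fun k _ => ?_
    rw [map_mul, Module.End.mul_apply, Y.inner_lmul]
  have h' : tensorInner X Y (∑ i ∈ S, i.1 ⊗ₜ i.2) (∑ i ∈ S, i.1 ⊗ₜ i.2)
      = ∑ k : S, Y.inner (∑ i : S, Y.lmul (H k i) i.1.2) (∑ i : S, Y.lmul (H k i) i.1.2) := by
    rw [← Finset.sum_coe_sort S]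
    simp only [map_sum, LinearMap.sum_apply, h]
    symm
    rw [Finset.sum_comm]
    exact Finset.sum_congr rfl fun _ _ => Finset.sum_comm
  rw [h']
  refine Finset.sum_nonneg fun k _ => ?_
  exact CStarAlgebra.nonneg_iff_eq_star_mul_self.2 (Y.inner_self_nonneg _)

theorem tensorInner_lmul (a : A) (s t : X.carrier ⊗[ℂ] Y.carrier) :
    tensorInner X Y (tensorLmul X Y a s) t = tensorInner X Y s (tensorLmul X Y (star a) t) := by
  induction s using TensorProduct.induction_on with
  | zero => simp only [map_zero, LinearMap.zero_apply]
  | add s s' hs hs' => simp only [map_add, LinearMap.add_apply, hs, hs']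
  | tmul x y =>
    induction t using TensorProduct.induction_on with
    | zero => simp only [map_zero]
    | add t t' ht ht' => simp only [map_add, ht, ht']
    | tmul x' y' =>
      rw [tensorLmul_tmul, tensorLmul_tmul, tensorInner_tmul, tensorInner_tmul, X.inner_lmul]

/-- The algebraic tensor product over `ℂ` with its inner product and its two actions. -/
noncomputable def preTensor : PreCorrespondence.{u, v} A C where
  carrier := X.carrier ⊗[ℂ] Y.carrier
  inner := tensorInner X Y
  rmul := tensorRmul X Y
  lmul := tensorLmul X Y
  rmul_mul := tensorRmul_mul X Y
  inner_rmul := tensorInner_rmul X Y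
  star_inner := star_tensorInner X Y
  inner_self_nonneg := tensorInner_self_nonneg X Y
  inner_lmul := tensorInner_lmul X Y

/-- The interior tensor product `X ⊗_B Y` of an `A`-`B`-correspondence `X` and a
`B`-`C`-correspondence `Y`: the Hausdorff completion of the algebraic tensor product over `ℂ` in
the inner product `⟨x ⊗ y, x' ⊗ y'⟩ = ⟨y, φ_Y(⟨x, x'⟩) y'⟩`. The vectors of length zero, which are
divided out, are the span of the vectors `x b ⊗ y - x ⊗ φ_Y(b) y`. -/
noncomputable def tensor : Correspondence.{u, v} A C := (preTensor X Y).completion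

end preTensor

/-- The tensor powers of a correspondence over `A`: `tensorPowSucc E n` is `E^{⊗(n + 1)}`, where
`E^{⊗1} = E` and `E^{⊗(k + 1)} = E ⊗_A E^{⊗k}`. -/
noncomputable def tensorPowSucc (E : Correspondence.{u, v} A A) : ℕ → Correspondence.{u, v} A A
  | 0 => E
  | n + 1 => tensor E (tensorPowSucc E n)

/-- Unitary equivalence `X ≈ Y` of `A`-`B`-correspondences: there is a linear map of `X` onto `Y`
that preserves the inner products and intertwines the left and the right actions. (Such a map is
bijective, and adjointable with its inverse as the adjoint.) -/
def UnitarilyEquivalent (X Y : Correspondence.{u, v} A B) : Prop :=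
  ∃ U : X.carrier →ₗ[ℂ] Y.carrier, Function.Surjective U ∧
    (∀ x x', Y.inner (U x) (U x') = X.inner x x') ∧
    (∀ a x, U (X.lmul a x) = Y.lmul a (U x)) ∧
    (∀ b x, U (X.rmul b x) = Y.rmul b (U x))

end Correspondence

/-- An `A`-`B`-imprimitivity bimodule: an `A`-`B`-correspondence with a left inner product in `A`
(linear in the first variable) that is compatible with the right inner product,
`φ(⟨x, y⟩_left) z = x ⟨y, z⟩`, such that both inner products are full. (The two inner products then
define the same norm, so that the bimodule is complete on the left as well.) -/
structure ImprimitivityBimodule (A B : Type u) [NonUnitalCStarAlgebra A]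
    [NonUnitalCStarAlgebra B] extends Correspondence.{u, v} A B where
  leftInner : carrier →ₗ[ℂ] carrier →ₗ⋆[ℂ] A
  leftInner_lmul (a : A) (x y : carrier) : leftInner (lmul a x) y = a * leftInner x y
  star_leftInner (x y : carrier) : star (leftInner x y) = leftInner y x
  leftInner_self_nonneg (x : carrier) : ∃ a : A, leftInner x x = star a * a
  leftInner_self_eq_zero (x : carrier) : leftInner x x = 0 → x = 0
  lmul_leftInner (x y z : carrier) : lmul (leftInner x y) z = rmul (inner y z) x
  left_full : Dense
    (Submodule.span ℂ (Set.range fun p : carrier × carrier => leftInner p.1 p.2) : Set A)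
  right_full : Dense
    (Submodule.span ℂ (Set.range fun p : carrier × carrier => inner p.1 p.2) : Set B)

/-- A C⋆-algebra together with a C⋆-correspondence over it. -/
structure CorrespondenceOver where
  algebra : Type u
  [cstar : NonUnitalCStarAlgebra algebra]
  corr : Correspondence.{u, v} algebra algebra

attribute [instance] CorrespondenceOver.cstar

namespace Correspondence

/-- `E` is (strongly) Morita equivalent to `F`: `E ⊗_A M ≈ M ⊗_B F` for some
`A`-`B`-imprimitivity bimodule `M`. -/
def MoritaEquivalent (E : Correspondence.{u, v} A A) (F : Correspondence.{u, v} B B) : Prop :=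
  ∃ M : ImprimitivityBimodule.{u, v} A B,
    UnitarilyEquivalent (tensor E M.toCorrespondence) (tensor M.toCorrespondence F)

/-- `E` is elementary strong shift equivalent to `F`: `E ≈ R ⊗_B S` and `F ≈ S ⊗_A R` for some
correspondences `R` from `A` to `B` and `S` from `B` to `A`. -/
def ElementaryStrongShiftEquivalent (E : Correspondence.{u, v} A A)
    (F : Correspondence.{u, v} B B) : Prop :=
  ∃ (R : Correspondence.{u, v} A B) (S : Correspondence.{u, v} B A),
    UnitarilyEquivalent E (tensor R S) ∧ UnitarilyEquivalent F (tensor S R)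

/-- `E` is strong shift equivalent to `F`: a finite sequence of correspondences `T 0, …, T n`, each
over a C⋆-algebra of its own, leads from `T 0 = E` to `T n = F`, and each `T i` is elementary strong
shift equivalent to `T (i + 1)`. -/
def StrongShiftEquivalent (E : Correspondence.{u, v} A A) (F : Correspondence.{u, v} B B) : Prop :=
  ∃ (n : ℕ) (T : ℕ → CorrespondenceOver.{u, v}), T 0 = ⟨A, E⟩ ∧ T n = ⟨B, F⟩ ∧
    ∀ i < n, ElementaryStrongShiftEquivalent (T i).corr (T (i + 1)).corr

/-- `E` is shift equivalent to `F`, with some lag `m = n + 1 ≥ 1`. -/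
def ShiftEquivalent (E : Correspondence.{u, v} A A) (F : Correspondence.{u, v} B B) : Prop :=
  ∃ (n : ℕ) (R : Correspondence.{u, v} A B) (S : Correspondence.{u, v} B A),
    UnitarilyEquivalent (tensorPowSucc E n) (tensor R S) ∧
    UnitarilyEquivalent (tensorPowSucc F n) (tensor S R) ∧
    UnitarilyEquivalent (tensor E R) (tensor R F) ∧
    UnitarilyEquivalent (tensor S E) (tensor F S)

end Correspondence

end

/-! The engine is `UnitarilyEquivalent.of_generators`: up to unitary equivalence, a correspondence
is determined by the inner products and the left-action matrix coefficients of a family with dense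
span. It reduces every equivalence below that is not formal to an identity between simple tensors.
In particular the interior tensor product is associative (`tensor_assoc`) and respects `≈`
(`tensor_congr`), so correspondences can be manipulated like bimodules. One rule is missing: A ⊗ E ≈
E may fail, since left actions may be degenerate. Cancellation on the right survives, because the
right action on a Hilbert module is always nondegenerate.

Morita equivalence gives an elementary strong shift equivalence with R = M and S = F ⊗ M⋆, where M⋆
is the dual of M. Indeed R ⊗ S ≈ (M ⊗ F) ⊗ M⋆ ≈ (E ⊗ M) ⊗ M⋆ ≈ E by `tensor_tensor_dual`, and S ⊗ R
= (F ⊗ M⋆) ⊗ M ≈ F by `tensor_dual_tensor`. Both cancellations take place on the right; the choice S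
= M⋆ ⊗ E would need A ⊗ E ≈ E.

An elementary equivalence is a chain of length one. It is also a shift equivalence of lag one,
because E ⊗ R ≈ R ⊗ S ⊗ R ≈ R ⊗ F. Shift equivalence is transitive, with lags adding up
(`ShiftEquivalent.trans`), so every finite chain collapses to a single shift equivalence. -/

namespace Correspondence

variable {A B C D : Type u} [NonUnitalCStarAlgebra A] [NonUnitalCStarAlgebra B]
  [NonUnitalCStarAlgebra C] [NonUnitalCStarAlgebra D]

/-! ### Norm bounds and dense spanning families in Hilbert modules. -/

section basic

variable (X : Correspondence.{u, v} A B)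

theorem inner_rmul_left (x y : X.carrier) (b : B) :
    X.inner (X.rmul b x) y = star b * X.inner x y :=
  X.toPre.inner_rmul_left x y b

theorem norm_inner_le (x y : X.carrier) : ‖X.inner x y‖ ≤ ‖x‖ * ‖y‖ := by
  refine (pow_le_pow_iff_left₀ (norm_nonneg _) (by positivity) two_ne_zero).1 ?_
  rw [mul_pow, X.norm_sq, X.norm_sq]
  exact X.toPre.norm_inner_sq_le x y

theorem norm_lmul_le (a : A) (x : X.carrier) : ‖X.lmul a x‖ ≤ ‖a‖ * ‖x‖ := by
  -- The norm of `X` is tied to the inner product by `norm_sq`, whereas the seminorm of `X.toPre` is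
  -- this square root by definition.
  have h (y : X.carrier) : ‖y‖ = Real.sqrt ‖X.inner y y‖ := by
    rw [← X.norm_sq, Real.sqrt_sq (norm_nonneg y)]
  rw [h, h]
  exact X.toPre.norm_lmul_le a x

theorem norm_rmul_le (b : B) (x : X.carrier) : ‖X.rmul b x‖ ≤ ‖b‖ * ‖x‖ := by
  have h (y : X.carrier) : ‖y‖ = Real.sqrt ‖X.inner y y‖ := by
    rw [← X.norm_sq, Real.sqrt_sq (norm_nonneg y)]
  rw [h, h]
  exact X.toPre.norm_rmul_le b x

theorem continuous_lmul (a : A) : Continuous (X.lmul a) :=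
  ((X.lmul a).mkContinuous ‖a‖ (X.norm_lmul_le a)).continuous

theorem continuous_rmul_left (x : X.carrier) : Continuous fun b => X.rmul b x :=
  ((X.rmul.flip x).mkContinuous ‖x‖ fun b => by
    rw [mul_comm]; exact X.norm_rmul_le b x).continuous

theorem continuous_inner : Continuous fun p : X.carrier × X.carrier => X.inner p.1 p.2 := by
  let f : X.carrier →L⋆[ℂ] X.carrier →L[ℂ] B :=
    LinearMap.mkContinuous₂ X.inner 1 fun x y => by
      rw [one_mul]; exact X.norm_inner_le x y
  exact (f.continuous.comp continuous_fst).clm_apply continuous_snd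

/-- The linear span of the family `f` is dense. -/
def DenseSpan {ι : Type*} (f : ι → X.carrier) : Prop :=
  Dense (Submodule.span ℂ (Set.range f) : Set X.carrier)

variable {X}

theorem ext_inner {x y : X.carrier} (h : ∀ z, X.inner z x = X.inner z y) : x = y := by
  rw [← sub_eq_zero]
  refine X.inner_self_eq_zero _ ?_
  rw [map_sub (X.inner (x - y)), h, sub_self]

/-- A property that is stable under linear combinations and limits holds everywhere as soon as it
holds on a family with dense span. -/
theorem DenseSpan.mem {ι : Type*} {f : ι → X.carrier} (hf : X.DenseSpan f)
    {K : Submodule ℂ X.carrier} (hK : IsClosed (K : Set X.carrier)) (h : ∀ i, f i ∈ K)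
    (x : X.carrier) : x ∈ K := by
  have h1 : Submodule.span ℂ (Set.range f) ≤ K :=
    Submodule.span_le.2 (Set.range_subset_iff.2 h)
  exact closure_minimal (s := (Submodule.span ℂ (Set.range f) : Set X.carrier)) h1 hK (hf x)

theorem denseSpan_of_mem {ι : Type*} {f : ι → X.carrier}
    (h : ∀ x, x ∈ (Submodule.span ℂ (Set.range f)).topologicalClosure) : X.DenseSpan f := h

/-- The difference is orthogonal to a dense subspace, hence to itself. -/
theorem DenseSpan.ext_inner {ι : Type*} {f : ι → X.carrier} (hf : X.DenseSpan f)
    {x y : X.carrier} (h : ∀ i, X.inner x (f i) = X.inner y (f i)) : x = y := by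
  have h1 (z : X.carrier) : z ∈ LinearMap.ker (X.inner (x - y)) := by
    refine hf.mem (isClosed_eq (X.continuous_inner.comp (Continuous.prodMk_right (x - y)))
      continuous_const) (fun i => ?_) z
    rw [LinearMap.mem_ker, map_sub, LinearMap.sub_apply, h, sub_self]
  rw [← sub_eq_zero]
  exact X.inner_self_eq_zero _ (h1 _)

theorem inner_lmul_right (a : A) (x y : X.carrier) :
    X.inner x (X.lmul a y) = X.inner (X.lmul (star a) x) y := by
  rw [X.inner_lmul, star_star]

/-- Adjointable operators are automatically B-linear: paired with z, the operator moves to the left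
variable, out of the way of b. -/
theorem lmul_rmul (a : A) (b : B) (x : X.carrier) :
    X.lmul a (X.rmul b x) = X.rmul b (X.lmul a x) :=
  Correspondence.ext_inner fun z => by
    rw [inner_lmul_right, X.inner_rmul, X.inner_rmul, inner_lmul_right]

end basic

/-! ### Unitary equivalence tested on generators. -/

/-- Correspondences with generating families that have the same inner products and the same matrix
coefficients of the left action are unitarily equivalent. -/
theorem UnitarilyEquivalent.of_generators {X Y : Correspondence.{u, v} A B} {ι : Type*}
    (f : ι → X.carrier) (g : ι → Y.carrier) (hf : X.DenseSpan f) (hg : Y.DenseSpan g)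
    (h : ∀ s t, Y.inner (g s) (g t) = X.inner (f s) (f t))
    (hl : ∀ a s t, Y.inner (g s) (Y.lmul a (g t)) = X.inner (f s) (X.lmul a (f t))) :
    UnitarilyEquivalent X Y := by
  let p := Finsupp.linearCombination ℂ f
  let q := Finsupp.linearCombination ℂ g
  have hp : DenseRange p := by
    rw [DenseRange, ← LinearMap.coe_range, Finsupp.range_linearCombination]; exact hf
  have hpq (s t : ι →₀ ℂ) : Y.inner (q s) (q t) = X.inner (p s) (p t) := by
    simp only [p, q, Finsupp.linearCombination_apply, Finsupp.sum, map_sum, LinearMap.sum_apply,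
      map_smul, LinearMap.map_smulₛₗ, LinearMap.smul_apply, h]
  -- Every linear relation among the `f i` thus holds among the `g i`, so p s ↦ q s is well defined,
  -- isometric, and extends from the dense range of `p`.
  have hn (s : ι →₀ ℂ) : ‖q s‖ = ‖p s‖ := by
    rw [← pow_left_inj₀ (norm_nonneg _) (norm_nonneg _) two_ne_zero, X.norm_sq, Y.norm_sq, hpq]
  have hb : ∀ s, ‖q s‖ ≤ 1 * ‖p s‖ := fun s => by rw [hn, one_mul]
  let U : X.carrier →L[ℂ] Y.carrier := q.extendOfNorm p
  have hU (s) : U (p s) = q s := LinearMap.extendOfNorm_eq hp ⟨1, hb⟩ s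
  have hUf (i) : U (f i) = g i := by
    have := hU (Finsupp.single i 1)
    simpa [p, q] using this
  have hinner (x x') : Y.inner (U x) (U x') = X.inner x x' := by
    refine hp.induction_on₂ (p := fun x x' => Y.inner (U x) (U x') = X.inner x x') ?_
      (fun s t => by rw [hU, hU, hpq]) x x'
    exact isClosed_eq (Y.continuous_inner.comp
      ((U.continuous.comp continuous_fst).prodMk (U.continuous.comp continuous_snd)))
      X.continuous_inner
  have hiso : Isometry U := by
    refine AddMonoidHomClass.isometry_of_norm U fun x => ?_
    rw [← pow_left_inj₀ (norm_nonneg _) (norm_nonneg _) two_ne_zero, X.norm_sq, Y.norm_sq, hinner]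
  -- An isometry on a complete space has closed range, and this range contains all `g i`.
  have hsurj : Function.Surjective U := fun y => by
    refine hg.mem (K := LinearMap.range U.toLinearMap) ?_ (fun i => ⟨f i, hUf i⟩) y
    exact hiso.isClosedEmbedding.isClosed_range
  have hlmul (a x) : U (X.lmul a x) = Y.lmul a (U x) := by
    refine hf.mem (K := LinearMap.eqLocus (U.toLinearMap ∘ₗ X.lmul a) (Y.lmul a ∘ₗ U.toLinearMap))
      (isClosed_eq (U.continuous.comp (X.continuous_lmul a))
        ((Y.continuous_lmul a).comp U.continuous)) (fun t => ?_) x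
    -- Testing against g s = U (f s) suffices; there the claim is the equality `hl` of matrix
    -- coefficients.
    refine Eq.symm (hg.ext_inner fun s => ?_)
    change Y.inner (Y.lmul a (U (f t))) (g s) = Y.inner (U (X.lmul a (f t))) (g s)
    rw [← Y.star_inner, hUf, hl, ← hUf, hinner, X.star_inner]
  refine ⟨U.toLinearMap, hsurj, hinner, hlmul, fun b x => ?_⟩
  -- The right action needs no hypothesis: it is determined by the inner product once `U` is onto.
  refine Correspondence.ext_inner fun z => ?_
  obtain ⟨w, rfl⟩ := hsurj z
  change Y.inner (U w) (U (X.rmul b x)) = Y.inner (U w) (Y.rmul b (U x))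
  rw [Y.inner_rmul, hinner, hinner, X.inner_rmul]

theorem denseSpan_of_surjective {X : Correspondence.{u, v} A B} {ι : Type*} {f : ι → X.carrier}
    (hf : Function.Surjective f) : X.DenseSpan f := by
  rw [DenseSpan, hf.range_eq, Submodule.span_univ]
  exact dense_univ

theorem UnitarilyEquivalent.refl (X : Correspondence.{u, v} A B) : UnitarilyEquivalent X X :=
  ⟨LinearMap.id, fun x => ⟨x, rfl⟩, fun _ _ => rfl, fun _ _ => rfl, fun _ _ => rfl⟩

/-- Both spaces are generated by families indexed by the points of `X`: the values of `U` in `Y`,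
the points themselves in `X`. This avoids constructing the inverse of `U`. -/
theorem UnitarilyEquivalent.symm {X Y : Correspondence.{u, v} A B}
    (h : UnitarilyEquivalent X Y) : UnitarilyEquivalent Y X := by
  obtain ⟨U, hs, hi, hl, -⟩ := h
  exact .of_generators U id (denseSpan_of_surjective hs)
    (denseSpan_of_surjective Function.surjective_id) (fun s t => (hi s t).symm)
    fun a s t => by rw [← hl, hi]; rfl

theorem UnitarilyEquivalent.trans {X Y Z : Correspondence.{u, v} A B}
    (h : UnitarilyEquivalent X Y) (h' : UnitarilyEquivalent Y Z) : UnitarilyEquivalent X Z := by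
  obtain ⟨U, hs, hi, hl, hr⟩ := h
  obtain ⟨U', hs', hi', hl', hr'⟩ := h'
  refine ⟨U' ∘ₗ U, hs'.comp hs, fun x y => ?_, fun a x => ?_, fun b x => ?_⟩
  · simp only [LinearMap.comp_apply, hi', hi]
  · simp only [LinearMap.comp_apply, hl, hl']
  · simp only [LinearMap.comp_apply, hr, hr']

/-! ### Completions and the calculus of interior tensor products. -/

section completion

open UniformSpace

variable (P : PreCorrespondence.{u, v} A B)

/-- The canonical map of a pre-correspondence into its completion. -/
noncomputable def _root_.PreCorrespondence.toCompletion :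
    P.carrier →ₗ[ℂ] P.completion.carrier :=
  (Completion.toComplL (𝕜 := ℂ) (E := P.carrier)).toLinearMap

theorem inner_toCompletion (x y : P.carrier) :
    P.completion.inner (P.toCompletion x) (P.toCompletion y) = P.inner x y :=
  P.complInner_coe x y

theorem lmul_toCompletion (a : A) (x : P.carrier) :
    P.completion.lmul a (P.toCompletion x) = P.toCompletion (P.lmul a x) :=
  P.complLmul_coe a x

theorem denseRange_toCompletion : DenseRange P.toCompletion :=
  Completion.denseRange_coe (α := P.carrier)

theorem denseSpan_toCompletion : P.completion.DenseSpan P.toCompletion :=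
  (denseRange_toCompletion P).mono Submodule.subset_span

end completion

section tensor

/-- The simple tensor `x ⊗ y`. -/
noncomputable def tmul (X : Correspondence.{u, v} A B) (Y : Correspondence.{u, v} B C) :
    X.carrier →ₗ[ℂ] Y.carrier →ₗ[ℂ] (tensor X Y).carrier :=
  (TensorProduct.mk ℂ X.carrier Y.carrier).compr₂
    ((preTensor X Y).toCompletion : X.carrier ⊗[ℂ] Y.carrier →ₗ[ℂ] (tensor X Y).carrier)

variable {X : Correspondence.{u, v} A B} {Y : Correspondence.{u, v} B C}

theorem inner_tmul (x x' : X.carrier) (y y' : Y.carrier) :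
    (tensor X Y).inner (tmul X Y x y) (tmul X Y x' y') = Y.inner y (Y.lmul (X.inner x x') y') :=
  inner_toCompletion (preTensor X Y) _ _

theorem lmul_tmul (a : A) (x : X.carrier) (y : Y.carrier) :
    (tensor X Y).lmul a (tmul X Y x y) = tmul X Y (X.lmul a x) y :=
  lmul_toCompletion (preTensor X Y) _ _

theorem norm_tmul_le (x : X.carrier) (y : Y.carrier) : ‖tmul X Y x y‖ ≤ ‖x‖ * ‖y‖ := by
  refine (pow_le_pow_iff_left₀ (norm_nonneg _) (by positivity) two_ne_zero).1 ?_
  rw [(tensor X Y).norm_sq, inner_tmul]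
  calc _ ≤ ‖y‖ * ‖Y.lmul (X.inner x x) y‖ := Y.norm_inner_le _ _
    _ ≤ ‖y‖ * (‖X.inner x x‖ * ‖y‖) := by gcongr; exact Y.norm_lmul_le _ _
    _ = (‖x‖ * ‖y‖) ^ 2 := by rw [← X.norm_sq]; ring

theorem continuous_tmul_right (x : X.carrier) : Continuous (tmul X Y x) :=
  ((tmul X Y x).mkContinuous ‖x‖ (norm_tmul_le x)).continuous

theorem continuous_tmul_left (y : Y.carrier) : Continuous ((tmul X Y).flip y) :=
  (((tmul X Y).flip y).mkContinuous ‖y‖ fun x => by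
    rw [mul_comm]; exact norm_tmul_le x y).continuous

theorem denseSpan_tmul_univ :
    (tensor X Y).DenseSpan fun p : X.carrier × Y.carrier => tmul X Y p.1 p.2 := by
  let κ : X.carrier ⊗[ℂ] Y.carrier →ₗ[ℂ] (tensor X Y).carrier := (preTensor X Y).toCompletion
  refine (denseRange_toCompletion (preTensor X Y)).mono ?_
  rintro _ ⟨t, rfl⟩
  change κ t ∈ Submodule.span ℂ _
  induction t using TensorProduct.induction_on with
  | zero => exact κ.map_zero ▸ Submodule.zero_mem _
  | add s t hs ht => exact κ.map_add s t ▸ Submodule.add_mem _ hs ht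
  | tmul x y => exact Submodule.subset_span ⟨(x, y), rfl⟩

/-- Simple tensors are linear and continuous in each variable, so the closed span absorbs arbitrary
vectors one variable at a time. -/
theorem DenseSpan.tensor_tmul {ι κ : Type*} {f : ι → X.carrier} {g : κ → Y.carrier}
    (hf : X.DenseSpan f) (hg : Y.DenseSpan g) :
    (tensor X Y).DenseSpan fun p : ι × κ => tmul X Y (f p.1) (g p.2) := by
  set K := (Submodule.span ℂ (Set.range fun p : ι × κ =>
    tmul X Y (f p.1) (g p.2))).topologicalClosure
  have hK : IsClosed (K : Set (tensor X Y).carrier) := Submodule.isClosed_topologicalClosure _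
  refine denseSpan_of_mem fun t => denseSpan_tmul_univ.mem hK (fun ⟨x, y⟩ => ?_) t
  refine hf.mem (K := K.comap ((tmul X Y).flip y))
    (hK.preimage (continuous_tmul_left y)) (fun i => ?_) x
  refine hg.mem (K := K.comap (tmul X Y (f i)))
    (hK.preimage (continuous_tmul_right _)) (fun k => ?_) y
  exact Submodule.le_topologicalClosure _ (Submodule.subset_span ⟨(i, k), rfl⟩)

theorem denseSpan_id (X : Correspondence.{u, v} A B) : X.DenseSpan id :=
  denseSpan_of_surjective Function.surjective_id

theorem UnitarilyEquivalent.tensor_congr {X X' : Correspondence.{u, v} A B}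
    {Y Y' : Correspondence.{u, v} B C} (h : UnitarilyEquivalent X X')
    (h' : UnitarilyEquivalent Y Y') :
    UnitarilyEquivalent (tensor X Y) (tensor X' Y') := by
  obtain ⟨U, hs, hi, hl, -⟩ := h
  obtain ⟨V, hs', hi', hl', -⟩ := h'
  refine .of_generators _ _ denseSpan_tmul_univ
    ((denseSpan_of_surjective hs).tensor_tmul (denseSpan_of_surjective hs')) ?_ ?_
  · intro s t
    simp only [inner_tmul, hi, ← hl', hi']
  · intro a s t
    simp only [lmul_tmul, inner_tmul, ← hl, hi, ← hl', hi']

theorem tensor_assoc (X : Correspondence.{u, v} A B) (Y : Correspondence.{u, v} B C)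
    (Z : Correspondence.{u, v} C D) :
    UnitarilyEquivalent (tensor (tensor X Y) Z) (tensor X (tensor Y Z)) := by
  have h1 : (tensor (tensor X Y) Z).DenseSpan fun p : (X.carrier × Y.carrier) × Z.carrier =>
      tmul (tensor X Y) Z (tmul X Y p.1.1 p.1.2) p.2 :=
    DenseSpan.tensor_tmul (f := fun p : X.carrier × Y.carrier => tmul X Y p.1 p.2) (g := id)
      denseSpan_tmul_univ (denseSpan_id Z)
  have h2 : (tensor X (tensor Y Z)).DenseSpan fun p : X.carrier × Y.carrier × Z.carrier =>
      tmul X (tensor Y Z) p.1 (tmul Y Z p.2.1 p.2.2) :=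
    DenseSpan.tensor_tmul (f := id) (g := fun p : Y.carrier × Z.carrier => tmul Y Z p.1 p.2)
      (denseSpan_id X) denseSpan_tmul_univ
  -- Reindexing gives the two generating families a common index type, as `of_generators` requires.
  have h3 : (tensor X (tensor Y Z)).DenseSpan fun p : (X.carrier × Y.carrier) × Z.carrier =>
      tmul X (tensor Y Z) p.1.1 (tmul Y Z p.1.2 p.2) := by
    rw [DenseSpan, ← (Equiv.prodAssoc _ _ _).surjective.range_comp] at h2
    exact h2
  refine .of_generators _ _ h1 h3 ?_ ?_
  · intro s t
    simp only [inner_tmul, lmul_tmul]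
  · intro a s t
    simp only [inner_tmul, lmul_tmul]

end tensor

end Correspondence

/-! ### Nondegeneracy of the right action. -/

namespace Correspondence

variable {A B : Type u} [NonUnitalCStarAlgebra A] [NonUnitalCStarAlgebra B]

/-- The right action of a C⋆-algebra on a Hilbert module is nondegenerate. -/
theorem mem_closure_range_rmul (X : Correspondence.{u, v} A B) (x : X.carrier) :
    x ∈ closure (Set.range fun b => X.rmul b x) := by
  let _ : PartialOrder B := CStarAlgebra.spectralOrder B
  have _ : StarOrderedRing B := CStarAlgebra.spectralOrderedRing B
  have hu := CStarAlgebra.increasingApproximateUnit B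
  have _ := hu.neBot
  set l := CStarAlgebra.approximateUnit B
  set c := X.inner x x with hc
  -- For ‖b‖ ≤ 1 the right-hand side is at most 2‖cb - c‖, which tends to 0 along an approximate
  -- unit.
  have h1 (b : B) : ‖X.rmul b x - x‖ ^ 2 = ‖star b * (c * b - c) - (c * b - c)‖ := by
    rw [X.norm_sq]
    simp only [map_sub, LinearMap.sub_apply, X.inner_rmul, X.inner_rmul_left, ← hc, mul_sub,
      mul_assoc]
    congr 1
    abel
  have h2 : Filter.Tendsto (fun b => c * b - c) l (nhds 0) := by
    simpa using (hu.tendsto_mul_left c).sub_const c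
  have h3 : Filter.Tendsto (fun b => 2 * ‖c * b - c‖) l (nhds 0) := by
    simpa using h2.norm.const_mul 2
  have h4 : Filter.Tendsto (fun b => ‖X.rmul b x - x‖ ^ 2) l (nhds 0) := by
    refine squeeze_zero' (.of_forall fun _ => by positivity) ?_ h3
    filter_upwards [hu.eventually_norm] with b hb
    rw [h1, two_mul]
    refine (norm_sub_le _ _).trans (add_le_add_left ?_ _)
    refine (norm_mul_le _ _).trans ?_
    rw [norm_star]
    exact mul_le_of_le_one_left (norm_nonneg _) hb
  have h5 : Filter.Tendsto (fun b => ‖X.rmul b x - x‖) l (nhds 0) := by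
    have := h4.sqrt
    simpa using this
  exact mem_closure_of_tendsto (tendsto_iff_norm_sub_tendsto_zero.2 h5)
    (.of_forall fun b => ⟨b, rfl⟩)

/-- If the family `c` has dense linear span in `B`, then the vectors `x (c i)` span a dense subspace
of a right Hilbert `B`-module. -/
theorem denseSpan_rmul (X : Correspondence.{u, v} A B) {ι : Type*} {c : ι → B}
    (hc : Dense (Submodule.span ℂ (Set.range c) : Set B)) :
    X.DenseSpan fun p : X.carrier × ι => X.rmul (c p.2) p.1 := by
  set K := (Submodule.span ℂ (Set.range fun p : X.carrier × ι =>
    X.rmul (c p.2) p.1)).topologicalClosure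
  have hK : IsClosed (K : Set X.carrier) := Submodule.isClosed_topologicalClosure _
  -- For fixed x the map b ↦ x b is linear and continuous, so membership in `K` passes from the `c
  -- i` to all of `B`.
  have h1 (x : X.carrier) (b : B) : X.rmul b x ∈ K := by
    let K' : Submodule ℂ B := K.comap (X.rmul.flip x)
    have h2 : Submodule.span ℂ (Set.range c) ≤ K' := by
      refine Submodule.span_le.2 ?_
      rintro _ ⟨i, rfl⟩
      exact Submodule.le_topologicalClosure _ (Submodule.subset_span ⟨(x, i), rfl⟩)
    exact closure_minimal (s := (Submodule.span ℂ (Set.range c) : Set B)) h2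
      (hK.preimage (X.continuous_rmul_left x)) (hc b)
  refine denseSpan_of_mem fun x => ?_
  refine closure_minimal ?_ hK (X.mem_closure_range_rmul x)
  rintro _ ⟨b, rfl⟩
  exact h1 x b

end Correspondence

/-! ### The dual of an imprimitivity bimodule and the cancellation of M against it. -/

namespace ImprimitivityBimodule

open Correspondence

variable {A B : Type u} [NonUnitalCStarAlgebra A] [NonUnitalCStarAlgebra B]
variable (M : ImprimitivityBimodule.{u, v} A B)

/-- By left fullness, `a` annihilates a dense subspace of `A`, hence a a⋆ = 0. Faithfulness lets
identities in `A` be checked by their action on `M`. -/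
theorem eq_zero_of_lmul_eq_zero {a : A} (h : ∀ x, M.lmul a x = 0) : a = 0 := by
  have h1 : Submodule.span ℂ (Set.range fun p : M.carrier × M.carrier => M.leftInner p.1 p.2)
      ≤ LinearMap.ker (LinearMap.mulLeft ℂ a) := by
    refine Submodule.span_le.2 ?_
    rintro _ ⟨⟨x, y⟩, rfl⟩
    change a * M.leftInner x y = 0
    rw [← M.leftInner_lmul, h, map_zero, LinearMap.zero_apply]
  have h2 : a * star a = 0 :=
    closure_minimal (t := {c | a * c = 0}) h1
      (isClosed_eq (continuous_const.mul continuous_id) continuous_const) (M.left_full (star a))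
  exact CStarRing.mul_star_self_eq_zero_iff a |>.1 h2

theorem leftInner_lmul_right (a : A) (x y : M.carrier) :
    M.leftInner x (M.lmul a y) = M.leftInner x y * star a := by
  rw [← M.star_leftInner, M.leftInner_lmul, star_mul, M.star_leftInner]

/-- Both sides act on z as x ↦ x b⟨y, z⟩, by the compatibility of the two inner products. This is
what makes the left action of `B` on the dual a ⋆-action. -/
theorem leftInner_rmul (b : B) (x y : M.carrier) :
    M.leftInner (M.rmul b x) y = M.leftInner x (M.rmul (star b) y) := by
  rw [← sub_eq_zero]
  refine M.eq_zero_of_lmul_eq_zero fun z => ?_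
  rw [map_sub, LinearMap.sub_apply, M.lmul_leftInner, M.lmul_leftInner, M.inner_rmul_left,
    star_star, M.rmul_mul, sub_self]

/-- A copy of the underlying group of `M`, with the conjugate scalar multiplication. -/
def Conj : Type v := M.carrier

instance : AddCommGroup M.Conj := inferInstanceAs (AddCommGroup M.carrier)

noncomputable instance : Module ℂ M.Conj :=
  Module.compHom M.carrier (starRingEnd ℂ)

/-- The conjugate linear identification of `M` with its conjugate. -/
noncomputable def toConj : M.carrier ≃ₗ⋆[ℂ] M.Conj where
  toFun x := x
  invFun x := x
  map_add' _ _ := rfl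
  map_smul' c x := by
    change c • x = (starRingEnd ℂ) ((starRingEnd ℂ) c) • x
    rw [Complex.conj_conj]
  left_inv _ := rfl
  right_inv _ := rfl

/-- The conjugate of a linear endomorphism of `M`. -/
noncomputable def conjEnd (f : Module.End ℂ M.carrier) : Module.End ℂ M.Conj :=
  M.toConj.toLinearMap ∘ₛₗ f ∘ₛₗ M.toConj.symm.toLinearMap

theorem conjEnd_toConj (f : Module.End ℂ M.carrier) (x : M.carrier) :
    M.conjEnd f (M.toConj x) = M.toConj (f x) := rfl

/-- The dual of an imprimitivity bimodule, before completion: the conjugate space, with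
`⟨x⋆, y⋆⟩ = _⟨x, y⟩`, `x⋆ a = (a⋆ x)⋆` and `b x⋆ = (x b⋆)⋆`. -/
noncomputable def preDual : PreCorrespondence.{u, v} B A where
  carrier := M.Conj
  inner := LinearMap.mk₂'ₛₗ (starRingEnd ℂ) (RingHom.id ℂ)
    (fun x y => M.leftInner (M.toConj.symm x) (M.toConj.symm y))
    (fun _ _ _ => by simp) (fun c x _ => by simp [map_smulₛₗ M.toConj.symm c x])
    (fun _ _ _ => by simp) (fun c _ y => by simp [map_smulₛₗ M.toConj.symm c y])
  rmul :=
    { toFun := fun a => M.conjEnd (M.lmul (star a))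
      map_add' := fun a b => by
        ext x; obtain ⟨x, rfl⟩ := M.toConj.surjective x
        simp [conjEnd_toConj]
      map_smul' := fun c a => by
        ext x; obtain ⟨x, rfl⟩ := M.toConj.surjective x
        simp [conjEnd_toConj, map_smulₛₗ M.toConj] }
  lmul :=
    { toFun := fun b => M.conjEnd (M.rmul (star b))
      map_add' := fun a b => by
        ext x; obtain ⟨x, rfl⟩ := M.toConj.surjective x
        simp [conjEnd_toConj]
      map_smul' := fun c a => by
        ext x; obtain ⟨x, rfl⟩ := M.toConj.surjective x
        simp [conjEnd_toConj, map_smulₛₗ M.toConj]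
      map_zero' := by
        ext x; obtain ⟨x, rfl⟩ := M.toConj.surjective x
        simp [conjEnd_toConj]
      map_mul' := fun a b => by
        ext x; obtain ⟨x, rfl⟩ := M.toConj.surjective x
        simp [conjEnd_toConj, M.rmul_mul] }
  rmul_mul a b x := by
    obtain ⟨x, rfl⟩ := M.toConj.surjective x
    simp [conjEnd_toConj]
  inner_rmul x y a := by
    obtain ⟨y, rfl⟩ := M.toConj.surjective y
    simp [conjEnd_toConj, leftInner_lmul_right]
  star_inner x y := M.star_leftInner _ _
  inner_self_nonneg x := M.leftInner_self_nonneg _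
  inner_lmul b x y := by
    obtain ⟨x, rfl⟩ := M.toConj.surjective x
    obtain ⟨y, rfl⟩ := M.toConj.surjective y
    simp [conjEnd_toConj, leftInner_rmul]

/-- The dual correspondence of an imprimitivity bimodule. -/
noncomputable def dual : Correspondence.{u, v} B A := M.preDual.completion

/-- The canonical map `x ↦ x⋆` of `M` into its dual. -/
noncomputable def toDual (x : M.carrier) : M.dual.carrier := M.preDual.toCompletion (M.toConj x)

theorem inner_toDual (x y : M.carrier) : M.dual.inner (M.toDual x) (M.toDual y) = M.leftInner x y :=
  inner_toCompletion M.preDual _ _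

theorem lmul_toDual (b : B) (x : M.carrier) :
    M.dual.lmul b (M.toDual x) = M.toDual (M.rmul (star b) x) :=
  lmul_toCompletion M.preDual _ _

theorem denseSpan_toDual : M.dual.DenseSpan M.toDual :=
  denseSpan_toCompletion M.preDual

/-- The unitary sends (e ⊗ m) ⊗ n⋆ to e · _⟨m, n⟩. Left fullness together with nondegeneracy of the
right action makes these images generate `E`. -/
theorem tensor_tensor_dual (E : Correspondence.{u, v} A A) :
    UnitarilyEquivalent (tensor (tensor E M.toCorrespondence) M.dual) E := by
  have h1 : (tensor (tensor E M.toCorrespondence) M.dual).DenseSpan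
      fun p : (E.carrier × M.carrier) × M.carrier =>
        tmul (tensor E M.toCorrespondence) M.dual (tmul E M.toCorrespondence p.1.1 p.1.2)
          (M.toDual p.2) :=
    DenseSpan.tensor_tmul (f := fun p : E.carrier × M.carrier => tmul E M.toCorrespondence p.1 p.2)
      denseSpan_tmul_univ M.denseSpan_toDual
  have h2 : E.DenseSpan fun p : (E.carrier × M.carrier) × M.carrier =>
      E.rmul (M.leftInner p.1.2 p.2) p.1.1 := by
    have := E.denseSpan_rmul M.left_full
    rw [DenseSpan, ← (Equiv.prodAssoc _ _ _).surjective.range_comp] at this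
    exact this
  -- Both sides equal _⟨n, m⟩ ⟨x, x'⟩ _⟨m', n'⟩.
  have key (x x' : E.carrier) (m n m' n' : M.carrier) :
      E.inner (E.rmul (M.leftInner m n) x) (E.rmul (M.leftInner m' n') x') =
        M.dual.inner (M.toDual n) (M.dual.lmul (M.inner m (M.lmul (E.inner x x') m'))
          (M.toDual n')) := by
    rw [E.inner_rmul, E.inner_rmul_left, lmul_toDual, inner_toDual, M.star_inner,
      ← M.lmul_leftInner, leftInner_lmul_right, M.star_leftInner, M.star_leftInner,
      M.leftInner_lmul, mul_assoc]
  refine .of_generators _ _ h1 h2 ?_ ?_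
  · intro s t
    simp only [key, inner_tmul]
  · intro a s t
    -- Since the two actions commute, this is `key` with φ(a) x' in place of x'.
    simp only [lmul_rmul, key, inner_tmul, lmul_tmul]

/-- The mirror image: (f ⊗ m⋆) ⊗ n corresponds to f · ⟨m, n⟩, and right fullness makes these vectors
generate `F`. -/
theorem tensor_dual_tensor (F : Correspondence.{u, v} B B) :
    UnitarilyEquivalent F (tensor (tensor F M.dual) M.toCorrespondence) := by
  have h1 : (tensor (tensor F M.dual) M.toCorrespondence).DenseSpan
      fun p : (F.carrier × M.carrier) × M.carrier =>
        tmul (tensor F M.dual) M.toCorrespondence (tmul F M.dual p.1.1 (M.toDual p.1.2)) p.2 :=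
    DenseSpan.tensor_tmul (f := fun p : F.carrier × M.carrier => tmul F M.dual p.1 (M.toDual p.2))
      (g := id) (DenseSpan.tensor_tmul (f := id) (denseSpan_id F) M.denseSpan_toDual)
      (denseSpan_id M.toCorrespondence)
  have h2 : F.DenseSpan fun p : (F.carrier × M.carrier) × M.carrier =>
      F.rmul (M.inner p.1.2 p.2) p.1.1 := by
    have := F.denseSpan_rmul M.right_full
    rw [DenseSpan, ← (Equiv.prodAssoc _ _ _).surjective.range_comp] at this
    exact this
  -- Both sides equal ⟨n, m⟩ ⟨x, x'⟩ ⟨m', n'⟩.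
  have key (x x' : F.carrier) (m n m' n' : M.carrier) :
      M.inner n (M.lmul (M.dual.inner (M.toDual m) (M.dual.lmul (F.inner x x') (M.toDual m'))) n') =
        F.inner (F.rmul (M.inner m n) x) (F.rmul (M.inner m' n') x') := by
    rw [F.inner_rmul, F.inner_rmul_left, lmul_toDual, inner_toDual, M.lmul_leftInner, M.inner_rmul,
      M.inner_rmul_left, star_star, M.star_inner, mul_assoc]
  refine .of_generators _ _ h2 h1 ?_ ?_
  · intro s t
    simp only [inner_tmul, key]
  · intro a s t
    simp only [lmul_rmul, inner_tmul, lmul_tmul, key]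

end ImprimitivityBimodule

/-! ### The three implications. -/

namespace Correspondence

variable {A B C : Type u} [NonUnitalCStarAlgebra A] [NonUnitalCStarAlgebra B]
  [NonUnitalCStarAlgebra C]

theorem MoritaEquivalent.elementaryStrongShiftEquivalent {E : Correspondence.{u, v} A A}
    {F : Correspondence.{u, v} B B} (h : E.MoritaEquivalent F) :
    E.ElementaryStrongShiftEquivalent F := by
  obtain ⟨M, hM⟩ := h
  refine ⟨M.toCorrespondence, tensor F M.dual, ?_, M.tensor_dual_tensor F⟩
  exact ((tensor_assoc _ _ _).symm.trans
    ((hM.symm.tensor_congr (.refl _)).trans (M.tensor_tensor_dual E))).symm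

theorem ElementaryStrongShiftEquivalent.strongShiftEquivalent {E : Correspondence.{u, v} A A}
    {F : Correspondence.{u, v} B B} (h : E.ElementaryStrongShiftEquivalent F) :
    E.StrongShiftEquivalent F := by
  refine ⟨1, fun i => if i = 0 then ⟨A, E⟩ else ⟨B, F⟩, rfl, rfl, fun i hi => ?_⟩
  obtain rfl : i = 0 := by omega
  exact h

/-- Index k stands for exponent k + 1, so the exponents add as (m + 1) + (n + 1) = (m + n + 1) + 1.
-/
theorem tensorPowSucc_add (E : Correspondence.{u, v} A A) (m n : ℕ) :
    UnitarilyEquivalent (tensor (tensorPowSucc E m) (tensorPowSucc E n))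
      (tensorPowSucc E (m + n + 1)) := by
  induction m with
  | zero => rw [Nat.zero_add]; exact .refl _
  | succ m ih =>
    rw [Nat.add_right_comm m 1 n]
    exact (tensor_assoc _ _ _).trans ((UnitarilyEquivalent.refl E).tensor_congr ih)

theorem UnitarilyEquivalent.tensorPowSucc_tensor {E : Correspondence.{u, v} A A}
    {F : Correspondence.{u, v} B B} {R : Correspondence.{u, v} A B}
    (h : UnitarilyEquivalent (tensor E R) (tensor R F)) (n : ℕ) :
    UnitarilyEquivalent (tensor (tensorPowSucc E n) R)
      (tensor R (tensorPowSucc F n)) := by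
  induction n with
  | zero => exact h
  | succ n ih =>
    exact (tensor_assoc _ _ _).trans <| ((UnitarilyEquivalent.refl E).tensor_congr ih).trans <|
      (tensor_assoc _ _ _).symm.trans <| (h.tensor_congr (.refl _)).trans (tensor_assoc _ _ _)

/-- Lag 2 with R = S = E makes every condition hold by definition. Lag 1 with R = E and S = A could
fail, since A ⊗ E ≈ E is not available. -/
theorem ShiftEquivalent.refl (E : Correspondence.{u, v} A A) : E.ShiftEquivalent E :=
  ⟨1, E, E, .refl _, .refl _, .refl _, .refl _⟩

/-- With m = n + 1 and m' = n' + 1: E^(m' + m) ≈ E^m' ⊗ R ⊗ S ≈ R ⊗ F^m' ⊗ S ≈ R ⊗ R' ⊗ S' ⊗ S. One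
half of transitivity; the other half follows by exchanging roles. -/
theorem UnitarilyEquivalent.tensorPowSucc_tensor_tensor {E : Correspondence.{u, v} A A}
    {F : Correspondence.{u, v} B B} {R : Correspondence.{u, v} A B} {S : Correspondence.{u, v} B A}
    {R' : Correspondence.{u, v} B C} {S' : Correspondence.{u, v} C B} {n n' : ℕ}
    (h : UnitarilyEquivalent (tensorPowSucc E n) (tensor R S))
    (h' : UnitarilyEquivalent (tensorPowSucc F n') (tensor R' S'))
    (hR : UnitarilyEquivalent (tensor E R) (tensor R F)) :
    UnitarilyEquivalent (tensorPowSucc E (n' + n + 1))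
      (tensor (tensor R R') (tensor S' S)) :=
  (tensorPowSucc_add E n' n).symm.trans <| ((UnitarilyEquivalent.refl _).tensor_congr h).trans <|
    (tensor_assoc _ _ _).symm.trans <|
    ((hR.tensorPowSucc_tensor n').tensor_congr (.refl S)).trans <|
    (((UnitarilyEquivalent.refl R).tensor_congr h').tensor_congr (.refl S)).trans <|
    ((tensor_assoc _ _ _).symm.tensor_congr (.refl S)).trans (tensor_assoc _ _ _)

theorem UnitarilyEquivalent.tensor_intertwine {E : Correspondence.{u, v} A A}
    {F : Correspondence.{u, v} B B} {G : Correspondence.{u, v} C C} {R : Correspondence.{u, v} A B}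
    {R' : Correspondence.{u, v} B C}
    (h : UnitarilyEquivalent (tensor E R) (tensor R F))
    (h' : UnitarilyEquivalent (tensor F R') (tensor R' G)) :
    UnitarilyEquivalent (tensor E (tensor R R'))
      (tensor (tensor R R') G) :=
  (tensor_assoc _ _ _).symm.trans <| (h.tensor_congr (.refl _)).trans <|
    (tensor_assoc _ _ _).trans <| ((UnitarilyEquivalent.refl R).tensor_congr h').trans
      (tensor_assoc _ _ _).symm

theorem ShiftEquivalent.trans {E : Correspondence.{u, v} A A} {F : Correspondence.{u, v} B B}
    {G : Correspondence.{u, v} C C} (h : E.ShiftEquivalent F) (h' : F.ShiftEquivalent G) :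
    E.ShiftEquivalent G := by
  obtain ⟨n, R, S, h1, h2, h3, h4⟩ := h
  obtain ⟨n', R', S', h1', h2', h3', h4'⟩ := h'
  refine ⟨n' + n + 1, tensor R R', tensor S' S, h1.tensorPowSucc_tensor_tensor h1' h3, ?_,
    h3.tensor_intertwine h3', (h4'.symm.tensor_intertwine h4.symm).symm⟩
  -- Read from `G` back to `E`, the pairs (S', R') and (S, R) play the roles of (R, S) and (R', S'),
  -- which swaps the two lags.
  rw [Nat.add_comm n' n]
  exact h2'.tensorPowSucc_tensor_tensor h2 h4'.symm

theorem ElementaryStrongShiftEquivalent.shiftEquivalent {E : Correspondence.{u, v} A A}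
    {F : Correspondence.{u, v} B B} (h : E.ElementaryStrongShiftEquivalent F) :
    E.ShiftEquivalent F := by
  obtain ⟨R, S, h1, h2⟩ := h
  refine ⟨0, R, S, h1, h2, ?_, ?_⟩
  · exact (h1.tensor_congr (.refl R)).trans <| (tensor_assoc _ _ _).trans
      ((UnitarilyEquivalent.refl R).tensor_congr h2.symm)
  · exact ((UnitarilyEquivalent.refl S).tensor_congr h1).trans <| (tensor_assoc _ _ _).symm.trans
      (h2.symm.tensor_congr (.refl S))

theorem StrongShiftEquivalent.shiftEquivalent {E : Correspondence.{u, v} A A}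
    {F : Correspondence.{u, v} B B} (h : E.StrongShiftEquivalent F) : E.ShiftEquivalent F := by
  obtain ⟨n, T, h0, hn, hT⟩ := h
  have key : ∀ k ≤ n, (T 0).corr.ShiftEquivalent (T k).corr := by
    intro k
    induction k with
    | zero => exact fun _ => .refl _
    | succ k ih => exact fun hk => (ih (by omega)).trans (hT k (by omega)).shiftEquivalent
  have h1 := key n le_rfl
  -- These are equalities of bundled pairs, so each algebra is replaced together with its
  -- correspondence.
  rw [h0, hn] at h1
  exact h1

end Correspondence

theorem mainTheorem8 {A B : Type u} [NonUnitalCStarAlgebra A] [NonUnitalCStarAlgebra B]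
    (E : Correspondence.{u, v} A A) (F : Correspondence.{u, v} B B) :
    (E.MoritaEquivalent F → E.ElementaryStrongShiftEquivalent F) ∧
    (E.ElementaryStrongShiftEquivalent F → E.StrongShiftEquivalent F) ∧
    (E.StrongShiftEquivalent F → E.ShiftEquivalent F) :=
  ⟨fun h => h.elementaryStrongShiftEquivalent, fun h => h.strongShiftEquivalent,
    fun h => h.shiftEquivalent⟩
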